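/- Let $1\le p<\infty$ and let $E$ be a (real) Banach lattice, with topological dual $E^*$ carrying its usual Banach lattice structure. Recall that: - a sequence $(x_n)$ in a Banach space $X$ is weakly $p$-summable if $(\varphi(x_n))_n\in\ell_p$ for every $\varphi\in X^*$; - a sequence $(x_n)$ in a Banach lattice is disjoint if $|x_n|\wedge|x_m|=0$ for $n\ne m$; - a bounded linear operator from a Banach lattice to a Banach space is disjoint $p$-convergent if it maps disjoint weakly $p$-summable sequences to norm null sequences; - a bounded linear operator $T\colon E\to F$ between Banach lattices is almost weak $p$-convergent if $y_n^*(Tx_n)\to 0$ whenever $(x_n)$ is weakly null in $E$ and $(y_n^*)$ is disjoint and weakly $p$-summable in $F^*$. Then the norm of $E^*$ is order continuous (that is, every decreasing net in $E^*$ with infimum $0$ converges to $0$ in norm) if and only if, for every positive (bounded linear) almost weak $p$-convergent operator $T\colon E\to E$, the adjoint $T^*\colon E^*\to E^*$ is disjoint $p$-convergent. -/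

import Mathlib

open Filter Topology

set_option linter.unusedSectionVars false

namespace BanachLatticeDual

section Dual

variable {E : Type*} [NormedAddCommGroup E] [NormedSpace ℝ E] [Lattice E]
  [IsOrderedAddMonoid E] [HasSolidNorm E]

/-- The dual order: `f ≤ g` when `f x ≤ g x` on the positive cone. -/
noncomputable instance instPartialOrder : PartialOrder (StrongDual ℝ E) where
  le f g := ∀ x : E, 0 ≤ x → f x ≤ g x
  le_refl f x _ := le_rfl
  le_trans f g h hfg hgh x hx := (hfg x hx).trans (hgh x hx)
  le_antisymm f g hfg hgf := by
    have key : ∀ x : E, 0 ≤ x → f x = g x := fun x hx => le_antisymm (hfg x hx) (hgf x hx)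
    ext x
    rw [← posPart_sub_negPart x, map_sub, map_sub, key _ (posPart_nonneg x),
      key _ (negPart_nonneg x)]

theorem le_iff {f g : StrongDual ℝ E} : f ≤ g ↔ ∀ x : E, 0 ≤ x → f x ≤ g x := Iff.rfl

instance instIsOrderedAddMonoid : IsOrderedAddMonoid (StrongDual ℝ E) where
  add_le_add_left f g h k x hx := by
    simpa using h x hx

theorem norm_le_of_le {x y : E} (hx : 0 ≤ x) (h : x ≤ y) : ‖x‖ ≤ ‖y‖ :=
  norm_le_norm_of_abs_le_abs (by rwa [abs_of_nonneg hx, abs_of_nonneg (hx.trans h)])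

theorem apply_le (f : StrongDual ℝ E) {x y : E} (hx : 0 ≤ x) (h : x ≤ y) :
    f x ≤ ‖f‖ * ‖y‖ :=
  (le_abs_self _).trans ((f.le_opNorm x).trans
    (mul_le_mul_of_nonneg_left (norm_le_of_le hx h) (norm_nonneg f)))

/-- The Riesz–Kantorovich formula for the positive part of `f`, on the positive cone. -/
noncomputable def conePart (f : StrongDual ℝ E) (x : E) : ℝ := sSup (f '' Set.Icc 0 x)

theorem bddAbove_image (f : StrongDual ℝ E) (x : E) : BddAbove (f '' Set.Icc 0 x) :=
  ⟨‖f‖ * ‖x‖, by rintro _ ⟨y, hy, rfl⟩; exact apply_le f hy.1 hy.2⟩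

theorem nonempty_image (f : StrongDual ℝ E) {x : E} (hx : 0 ≤ x) :
    (f '' Set.Icc 0 x).Nonempty := ⟨f 0, 0, ⟨le_rfl, hx⟩, rfl⟩

theorem le_conePart (f : StrongDual ℝ E) {x y : E} (hy : 0 ≤ y) (h : y ≤ x) :
    f y ≤ conePart f x := le_csSup (bddAbove_image f x) ⟨y, ⟨hy, h⟩, rfl⟩

theorem conePart_nonneg (f : StrongDual ℝ E) {x : E} (hx : 0 ≤ x) : 0 ≤ conePart f x := by
  simpa using le_conePart f le_rfl hx

theorem conePart_le (f : StrongDual ℝ E) {x : E} (hx : 0 ≤ x) {c : ℝ}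
    (h : ∀ y, 0 ≤ y → y ≤ x → f y ≤ c) : conePart f x ≤ c :=
  csSup_le (nonempty_image f hx) (by rintro _ ⟨y, hy, rfl⟩; exact h y hy.1 hy.2)

theorem conePart_add (f : StrongDual ℝ E) {x y : E} (hx : 0 ≤ x) (hy : 0 ≤ y) :
    conePart f (x + y) = conePart f x + conePart f y := by
  apply le_antisymm
  · refine conePart_le f (add_nonneg hx hy) fun z hz hzxy => ?_
    have h1 : f (z ⊓ x) ≤ conePart f x := le_conePart f (le_inf hz hx) inf_le_right
    have h2 : f (z - z ⊓ x) ≤ conePart f y := by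
      refine le_conePart f (sub_nonneg.2 inf_le_left) ?_
      rw [sub_le_comm]
      exact le_inf (by simpa using hy) (sub_le_iff_le_add.2 hzxy)
    have h3 : f z = f (z ⊓ x) + f (z - z ⊓ x) := by rw [← map_add]; congr 1; abel
    linarith
  · have h1 : conePart f x ≤ conePart f (x + y) - conePart f y := by
      refine conePart_le f hx fun a ha hax => ?_
      have h2 : conePart f y ≤ conePart f (x + y) - f a := by
        refine conePart_le f hy fun b hb hby => ?_
        have := le_conePart f (add_nonneg ha hb) (add_le_add hax hby)
        rw [map_add] at this
        linarith
      linarith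
    linarith

/-- The additive extension to the whole lattice of `conePart f`. -/
noncomputable def posPartHom (f : StrongDual ℝ E) : E →+ ℝ :=
  AddMonoidHom.mk' (fun x => conePart f x⁺ - conePart f x⁻) fun x y => by
    have h : (x + y)⁺ + (x⁻ + y⁻) = (x + y)⁻ + (x⁺ + y⁺) := by
      have e := posPart_sub_negPart (x + y)
      have ex := posPart_sub_negPart x
      have ey := posPart_sub_negPart y
      have : (x + y)⁺ - (x + y)⁻ = (x⁺ - x⁻) + (y⁺ - y⁻) := by rw [e, ex, ey]
      rw [sub_eq_iff_eq_add] at this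
      rw [this]; abel
    have h' := congrArg (conePart f) h
    rw [conePart_add f (posPart_nonneg _) (add_nonneg (negPart_nonneg _) (negPart_nonneg _)),
      conePart_add f (negPart_nonneg _) (negPart_nonneg _),
      conePart_add f (negPart_nonneg _) (add_nonneg (posPart_nonneg _) (posPart_nonneg _)),
      conePart_add f (posPart_nonneg _) (posPart_nonneg _)] at h'
    linarith

theorem abs_posPartHom_le (f : StrongDual ℝ E) (x : E) : ‖posPartHom f x‖ ≤ ‖f‖ * ‖x‖ := by
  have hp : ‖x⁺‖ ≤ ‖x‖ := norm_le_norm_of_abs_le_abs (by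
    rw [abs_of_nonneg (posPart_nonneg x)]; exact sup_le (le_abs_self x) (abs_nonneg x))
  have hn : ‖x⁻‖ ≤ ‖x‖ := norm_le_norm_of_abs_le_abs (by
    rw [abs_of_nonneg (negPart_nonneg x)]; exact sup_le (neg_le_abs x) (abs_nonneg x))
  have h1 : conePart f x⁺ ≤ ‖f‖ * ‖x⁺‖ :=
    conePart_le f (posPart_nonneg x) fun y hy h => apply_le f hy h
  have h2 : conePart f x⁻ ≤ ‖f‖ * ‖x⁻‖ :=
    conePart_le f (negPart_nonneg x) fun y hy h => apply_le f hy h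
  have h3 := conePart_nonneg f (posPart_nonneg x)
  have h4 := conePart_nonneg f (negPart_nonneg x)
  have h5 := mul_le_mul_of_nonneg_left hp (norm_nonneg f)
  have h6 := mul_le_mul_of_nonneg_left hn (norm_nonneg f)
  change |conePart f x⁺ - conePart f x⁻| ≤ _
  rw [abs_le]
  constructor <;> linarith

/-- The positive part of a bounded functional, as a bounded functional. -/
noncomputable def dualPosPart (f : StrongDual ℝ E) : StrongDual ℝ E :=
  (posPartHom f).toRealLinearMap
    (AddMonoidHomClass.continuous_of_bound (posPartHom f) ‖f‖ (abs_posPartHom_le f))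

theorem dualPosPart_apply (f : StrongDual ℝ E) {x : E} (hx : 0 ≤ x) :
    dualPosPart f x = conePart f x := by
  change conePart f x⁺ - conePart f x⁻ = _
  rw [posPart_of_nonneg hx, negPart_of_nonneg hx]
  have : conePart f (0 : E) = 0 := by simp [conePart]
  rw [this, sub_zero]

/-- The dual is a lattice, with `f ⊔ g = g + (f - g)⁺`. -/
noncomputable instance instLattice : Lattice (StrongDual ℝ E) where
  toPartialOrder := instPartialOrder
  sup f g := g + dualPosPart (f - g)
  inf f g := -(-g + dualPosPart (-f - -g))
  le_sup_left f g x hx := by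
    have := le_conePart (f - g) hx le_rfl
    simp only [add_apply, dualPosPart_apply _ hx]
    simp only [sub_apply] at this
    linarith
  le_sup_right f g x hx := by
    have := conePart_nonneg (f - g) hx
    simp only [add_apply, dualPosPart_apply _ hx]
    linarith
  sup_le f g h hf hg x hx := by
    simp only [add_apply, dualPosPart_apply _ hx]
    have : conePart (f - g) x ≤ h x - g x := by
      refine conePart_le _ hx fun y hy hyx => ?_
      have h1 := hf y hy
      have h2 := hg (x - y) (sub_nonneg.2 hyx)
      simp only [map_sub] at h2
      simp only [sub_apply]
      linarith
    linarith
  inf_le_left f g x hx := by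
    have := le_conePart (-f - -g) hx le_rfl
    simp only [add_apply, neg_apply,
      dualPosPart_apply _ hx]
    simp only [sub_apply, neg_apply] at this
    linarith
  inf_le_right f g x hx := by
    have := conePart_nonneg (-f - -g) hx
    simp only [add_apply, neg_apply,
      dualPosPart_apply _ hx]
    linarith
  le_inf h f g hf hg x hx := by
    simp only [add_apply, neg_apply,
      dualPosPart_apply _ hx]
    have : conePart (-f - -g) x ≤ g x - h x := by
      refine conePart_le _ hx fun y hy hyx => ?_
      have h1 := hf y hy
      have h2 := hg (x - y) (sub_nonneg.2 hyx)
      simp only [map_sub] at h2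
      simp only [sub_apply, neg_apply]
      linarith
    linarith

theorem sup_eq (f g : StrongDual ℝ E) : f ⊔ g = g + dualPosPart (f - g) := rfl

theorem abs_apply_le (f : StrongDual ℝ E) (x : E) : |f x| ≤ |f| |x| := by
  have h1 : ∀ y : E, 0 ≤ y → |f y| ≤ |f| y := fun y hy => by
    have a := le_abs_self f y hy
    have b := neg_le_abs f y hy
    rw [neg_apply] at b
    exact abs_le'.2 ⟨a, b⟩
  have h2 := h1 _ (posPart_nonneg x)
  have h3 := h1 _ (negPart_nonneg x)
  have h4 : f x = f x⁺ - f x⁻ := by rw [← map_sub, posPart_sub_negPart]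
  have h5 : |f| |x| = |f| x⁺ + |f| x⁻ := by rw [← map_add, posPart_add_negPart]
  rw [h4, h5]
  exact (abs_sub _ _).trans (add_le_add h2 h3)

theorem abs_dual_apply_le (f : StrongDual ℝ E) {x : E} (hx : 0 ≤ x) : |f| x ≤ ‖f‖ * ‖x‖ := by
  rw [abs, sup_eq, add_apply, dualPosPart_apply _ hx,
    neg_apply]
  have : conePart (f - -f) x ≤ ‖f‖ * ‖x‖ + f x := by
    refine conePart_le _ hx fun y hy hyx => ?_
    have h1 : f (y - (x - y)) ≤ ‖f‖ * ‖x‖ := by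
      refine (le_abs_self _).trans ((f.le_opNorm _).trans
        (mul_le_mul_of_nonneg_left (norm_le_norm_of_abs_le_abs ?_) (norm_nonneg f)))
      rw [abs_of_nonneg hx]
      refine sup_le ((sub_le_self _ (sub_nonneg.2 hyx)).trans hyx) ?_
      rw [neg_sub]
      exact (sub_le_self _ hy).trans (sub_le_self _ hy)
    simp only [map_sub] at h1
    simp only [sub_apply, neg_apply]
    linarith
  linarith

instance instHasSolidNorm : HasSolidNorm (StrongDual ℝ E) where
  solid f g h := by
    refine f.opNorm_le_bound (norm_nonneg g) fun x => ?_
    calc ‖f x‖ ≤ |f| |x| := abs_apply_le f x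
      _ ≤ |g| |x| := h _ (abs_nonneg x)
      _ ≤ ‖g‖ * ‖|x|‖ := abs_dual_apply_le g (abs_nonneg x)
      _ = ‖g‖ * ‖x‖ := by rw [norm_abs_eq_norm]

instance instIsOrderedModule : IsOrderedModule ℝ (StrongDual ℝ E) where
  smul_le_smul_of_nonneg_left a ha f g h x hx := by
    simpa using mul_le_mul_of_nonneg_left (h x hx) ha
  smul_le_smul_of_nonneg_right f hf a b h x hx := by
    have := hf x hx
    simpa using mul_le_mul_of_nonneg_right h (by simpa using this)

end Dual

/-- Pairwise disjoint sequences of a vector lattice. -/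
def DisjointSeq {G : Type*} [Lattice G] [AddGroup G] (x : ℕ → G) : Prop :=
  ∀ m n : ℕ, m ≠ n → |x m| ⊓ |x n| = 0

/-- `(x n)` is weakly `p`-summable: `(φ (x n))` lies in `ℓ_p` for every bounded functional `φ`. -/
def WeaklyPSummable {X : Type*} [NormedAddCommGroup X] [NormedSpace ℝ X]
    (p : ℝ) (x : ℕ → X) : Prop :=
  ∀ φ : StrongDual ℝ X, Summable fun n => |φ (x n)| ^ p

/-- `(x n)` converges weakly to zero. -/
def WeaklyNull {X : Type*} [NormedAddCommGroup X] [NormedSpace ℝ X] (x : ℕ → X) : Prop :=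
  ∀ φ : StrongDual ℝ X, Tendsto (fun n => φ (x n)) atTop (𝓝 0)

/-- The norm is order continuous: every decreasing net with infimum `0`, i.e. every nonempty
downward directed set with infimum `0`, converges to `0` in norm. -/
def OrderContinuousNorm (G : Type*) [NormedAddCommGroup G] [Lattice G] : Prop :=
  ∀ D : Set G, D.Nonempty → DirectedOn (fun a b => b ≤ a) D → IsGLB D 0 →
    ∀ ε : ℝ, 0 < ε → ∃ d ∈ D, ∀ x ∈ D, x ≤ d → ‖x‖ < ε

/-- An operator from a Banach lattice to a Banach space is disjoint `p`-convergent if it maps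
disjoint weakly `p`-summable sequences to norm null sequences. -/
def DisjointPConvergent {G X : Type*} [NormedAddCommGroup G] [NormedSpace ℝ G] [Lattice G]
    [NormedAddCommGroup X] [NormedSpace ℝ X] (p : ℝ) (T : G →L[ℝ] X) : Prop :=
  ∀ x : ℕ → G, DisjointSeq x → WeaklyPSummable p x →
    Tendsto (fun n => ‖T (x n)‖) atTop (𝓝 0)

/-- An operator `T : E → F` between Banach lattices is almost weak `p`-convergent if
`y n (T (x n)) → 0` for all weakly null `x` in `E` and all disjoint weakly `p`-summable `y` in
the dual of `F`. -/
def AlmostWeakPConvergent {E F : Type*} [NormedAddCommGroup E] [NormedSpace ℝ E]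
    [NormedAddCommGroup F] [NormedSpace ℝ F] [Lattice F] [IsOrderedAddMonoid F] [HasSolidNorm F]
    (p : ℝ) (T : E →L[ℝ] F) : Prop :=
  ∀ (x : ℕ → E) (y : ℕ → StrongDual ℝ F), WeaklyNull x → DisjointSeq y →
    WeaklyPSummable p y → Tendsto (fun n => y n (T (x n))) atTop (𝓝 0)

/-- The Banach space adjoint `T* : F* → E*`, `T* f = f ∘ T`. -/
noncomputable def adjointOp {E F : Type*} [NormedAddCommGroup E] [NormedSpace ℝ E]
    [NormedAddCommGroup F] [NormedSpace ℝ F] (T : E →L[ℝ] F) :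
    StrongDual ℝ F →L[ℝ] StrongDual ℝ E :=
  ContinuousLinearMap.precomp ℝ T

theorem adjointOp_apply {E F : Type*} [NormedAddCommGroup E] [NormedSpace ℝ E]
    [NormedAddCommGroup F] [NormedSpace ℝ F] (T : E →L[ℝ] F) (f : StrongDual ℝ F) :
    adjointOp T f = f.comp T := rfl

end BanachLatticeDual

/-! Order continuity of the dual norm is decided on disjoint sequences. If it holds, every norm
bounded disjoint positive sequence in `E` is weakly null (`weaklyNull_of_disjoint`). If it fails,
some positive functional `f` stays above a `δ > 0` along a disjoint positive sequence `u` in the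
unit ball (`exists_disjoint_of_not_orderContinuousNorm`).

Order continuity is sufficient: positive parts preserve disjoint weak `p`-summability
(`WeaklyPSummable.posPart`), so the test sequence `y` may be taken positive. Then the functionals
`T* y n` are positive and pointwise null. If their norms do not tend to zero, disjointification
(`exists_disjoint_of_not_tendsto`) yields a disjoint bounded positive sequence `u` on which a
subsequence stays above some `δ > 0`. Since `u` is weakly null, this contradicts almost weak
`p`-convergence.

Order continuity is necessary: let `g k` be the component of `f` in the band generated by `u k`, and
put `T x = ∑ g k x • u k`. The `g k` are disjoint with sums below `f`, hence weakly `p`-summable. As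
`T` factors through `ℓ¹`, the Schur property makes it send weakly null sequences to norm null ones,
so it is almost weak `p`-convergent. But `(T* (g n)) (u n) ≥ (g n (u n))² ≥ δ²`. -/

namespace BanachLatticeDual

/-! ### Disjointness in lattice-ordered groups -/

section LatticeGroup

variable {G : Type*} [AddCommGroup G] [Lattice G] [IsOrderedAddMonoid G]

theorem add_inf_le_inf_add_inf {x y u : G} (hx : 0 ≤ x) (hy : 0 ≤ y) (hu : 0 ≤ u) :
    (x + y) ⊓ u ≤ x ⊓ u + y ⊓ u := by
  rw [inf_add, add_inf, add_inf]
  refine le_inf (le_inf inf_le_left ?_) (le_inf ?_ ?_)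
  · exact inf_le_right.trans (le_add_of_nonneg_left hx)
  · exact inf_le_right.trans (le_add_of_nonneg_right hy)
  · exact inf_le_right.trans (le_add_of_nonneg_right hu)

theorem inf_add_inf_le_add_inf_add {x y u v : G} : x ⊓ u + y ⊓ v ≤ (x + y) ⊓ (u + v) :=
  le_inf (add_le_add inf_le_left inf_le_left) (add_le_add inf_le_right inf_le_right)

theorem add_inf_eq_zero {a b c : G} (ha : 0 ≤ a) (hb : 0 ≤ b) (hc : 0 ≤ c)
    (hac : a ⊓ c = 0) (hbc : b ⊓ c = 0) : (a + b) ⊓ c = 0 :=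
  le_antisymm ((add_inf_le_inf_add_inf ha hb hc).trans (by rw [hac, hbc, add_zero]))
    (le_inf (add_nonneg ha hb) hc)

theorem inf_eq_zero_of_le {a b c d : G} (ha : 0 ≤ a) (hb : 0 ≤ b) (hac : a ≤ c) (hbd : b ≤ d)
    (h : c ⊓ d = 0) : a ⊓ b = 0 :=
  le_antisymm ((inf_le_inf hac hbd).trans h.le) (le_inf ha hb)

theorem sum_inf_eq_zero {a : ℕ → G} {c : G} (ha : ∀ i, 0 ≤ a i) (hc : 0 ≤ c) (N : ℕ)
    (h : ∀ i < N, a i ⊓ c = 0) : (∑ i ∈ Finset.range N, a i) ⊓ c = 0 := by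
  induction N with
  | zero => simpa using hc
  | succ N ih =>
    rw [Finset.sum_range_succ]
    exact add_inf_eq_zero (Finset.sum_nonneg fun i _ => ha i) (ha N) hc
      (ih fun i hi => h i (by omega)) (h N (by omega))

theorem nsmul_inf_eq_zero {a c : G} (ha : 0 ≤ a) (hc : 0 ≤ c) (h : a ⊓ c = 0) (m : ℕ) :
    (m • a) ⊓ c = 0 := by
  induction m with
  | zero => simpa using hc
  | succ m ih =>
    rw [succ_nsmul]
    exact add_inf_eq_zero (nsmul_nonneg ha m) ha hc ih h

theorem nsmul_inf_nsmul_eq_zero {a c : G} (ha : 0 ≤ a) (hc : 0 ≤ c) (h : a ⊓ c = 0) (m k : ℕ) :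
    (m • a) ⊓ (k • c) = 0 := by
  rw [inf_comm]
  refine nsmul_inf_eq_zero hc (nsmul_nonneg ha m) ?_ k
  rw [inf_comm]
  exact nsmul_inf_eq_zero ha hc h m

/-- Pairwise disjoint positive elements below `x` add up to an element below `x`. -/
theorem sum_le_of_disjoint {a : ℕ → G} {x : G} (ha : ∀ i, 0 ≤ a i) (hx : 0 ≤ x)
    (hd : ∀ i j, i ≠ j → a i ⊓ a j = 0) (hax : ∀ i, a i ≤ x) (N : ℕ) :
    ∑ i ∈ Finset.range N, a i ≤ x := by
  induction N with
  | zero => simpa using hx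
  | succ N ih =>
    rw [Finset.sum_range_succ, ← inf_add_sup,
      sum_inf_eq_zero ha (ha N) N fun i hi => hd i N (by omega), zero_add]
    exact sup_le ih (hax N)

theorem posPart_inf_posPart_neg (a : G) : a⁺ ⊓ (-a)⁺ = 0 := by
  simpa using posPart_inf_negPart_eq_zero a

end LatticeGroup

/-! ### Band components of positive functionals -/

section Functional

variable {E : Type*} [NormedAddCommGroup E] [NormedSpace ℝ E] [Lattice E]
  [IsOrderedAddMonoid E] [HasSolidNorm E]

theorem map_mono {f : StrongDual ℝ E} (hf : 0 ≤ f) {x y : E} (h : x ≤ y) : f x ≤ f y := by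
  have := hf (y - x) (sub_nonneg.2 h)
  simpa using this

theorem apply_nonneg {f : StrongDual ℝ E} (hf : 0 ≤ f) {x : E} (h : 0 ≤ x) : 0 ≤ f x := by
  simpa using map_mono hf h

theorem abs_map_le {f : StrongDual ℝ E} (hf : 0 ≤ f) (x : E) : |f x| ≤ f |x| := by
  simpa [abs_of_nonneg hf] using abs_apply_le f x

theorem norm_posPart_le (x : E) : ‖x⁺‖ ≤ ‖x‖ := norm_le_norm_of_abs_le_abs (by
  rw [abs_of_nonneg (posPart_nonneg x)]; exact sup_le (le_abs_self x) (abs_nonneg x))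

theorem norm_negPart_le (x : E) : ‖x⁻‖ ≤ ‖x‖ := norm_le_norm_of_abs_le_abs (by
  rw [abs_of_nonneg (negPart_nonneg x)]; exact sup_le (neg_le_abs x) (abs_nonneg x))

/-- An additive function on the positive cone, bounded by a multiple of the norm, extends to a
bounded functional. -/
theorem exists_functional_of_cone (c : E → ℝ) (M : ℝ) (hM : 0 ≤ M)
    (hc : ∀ x, 0 ≤ x → 0 ≤ c x) (hcM : ∀ x, 0 ≤ x → c x ≤ M * ‖x‖)
    (hadd : ∀ x y, 0 ≤ x → 0 ≤ y → c (x + y) = c x + c y) :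
    ∃ g : StrongDual ℝ E, ∀ x, 0 ≤ x → g x = c x := by
  have hc0 : c 0 = 0 := by simpa using hadd 0 0 le_rfl le_rfl
  let φ : E →+ ℝ := AddMonoidHom.mk' (fun x => c x⁺ - c x⁻) fun x y => by
    have h : (x + y)⁺ + (x⁻ + y⁻) = (x + y)⁻ + (x⁺ + y⁺) := by
      have e := posPart_sub_negPart (x + y)
      have ex := posPart_sub_negPart x
      have ey := posPart_sub_negPart y
      have : (x + y)⁺ - (x + y)⁻ = (x⁺ - x⁻) + (y⁺ - y⁻) := by rw [e, ex, ey]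
      rw [sub_eq_iff_eq_add] at this
      rw [this]; abel
    have h' := congrArg c h
    rw [hadd _ _ (posPart_nonneg _) (add_nonneg (negPart_nonneg _) (negPart_nonneg _)),
      hadd _ _ (negPart_nonneg _) (negPart_nonneg _),
      hadd _ _ (negPart_nonneg _) (add_nonneg (posPart_nonneg _) (posPart_nonneg _)),
      hadd _ _ (posPart_nonneg _) (posPart_nonneg _)] at h'
    linarith
  have hφ : ∀ x, ‖φ x‖ ≤ M * ‖x‖ := fun x => by
    have h1 := hcM _ (posPart_nonneg x)
    have h2 := hcM _ (negPart_nonneg x)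
    have h3 := hc _ (posPart_nonneg x)
    have h4 := hc _ (negPart_nonneg x)
    have h5 := mul_le_mul_of_nonneg_left (norm_posPart_le x) hM
    have h6 := mul_le_mul_of_nonneg_left (norm_negPart_le x) hM
    change |c x⁺ - c x⁻| ≤ _
    rw [abs_le]
    constructor <;> linarith
  refine ⟨φ.toRealLinearMap (AddMonoidHomClass.continuous_of_bound φ M hφ), fun x hx => ?_⟩
  change c x⁺ - c x⁻ = _
  rw [posPart_of_nonneg hx, negPart_of_nonneg hx, hc0, sub_zero]

/-- `g` is the component of `f` in the band generated by `u`. -/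
def IsComponent (f : StrongDual ℝ E) (u : E) (g : StrongDual ℝ E) : Prop :=
  ∀ x : E, 0 ≤ x → Tendsto (fun m : ℕ => f (x ⊓ m • u)) atTop (𝓝 (g x))

/-- The truncations `x ⊓ m • u` increase with `m`, so their values under `f` converge. Truncation is
subadditive at a fixed level and superadditive from level `m` to level `2m`, so the limit is
additive on the cone. -/
theorem exists_isComponent {f : StrongDual ℝ E} (hf : 0 ≤ f) {u : E} (hu : 0 ≤ u) :
    ∃ g, IsComponent f u g := by
  have hmono : ∀ x : E, Monotone fun m : ℕ => f (x ⊓ m • u) := fun x m k h =>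
    map_mono hf (inf_le_inf_left x (nsmul_le_nsmul_left hu h))
  have hle : ∀ (x : E) (m : ℕ), f (x ⊓ m • u) ≤ f x := fun x m => map_mono hf inf_le_left
  have hbdd : ∀ x : E, BddAbove (Set.range fun m : ℕ => f (x ⊓ m • u)) := fun x =>
    ⟨f x, by rintro _ ⟨m, rfl⟩; exact hle x m⟩
  have hlim := fun x => tendsto_atTop_ciSup (hmono x) (hbdd x)
  obtain ⟨g, hg⟩ := exists_functional_of_cone (fun x => ⨆ m : ℕ, f (x ⊓ m • u)) ‖f‖
    (norm_nonneg f)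
    (fun x hx => ge_of_tendsto' (hlim x) fun m =>
      apply_nonneg hf (le_inf hx (nsmul_nonneg hu m)))
    (fun x _ => le_of_tendsto' (hlim x) fun m =>
      (hle x m).trans ((le_abs_self _).trans (f.le_opNorm x)))
    (fun x y hx hy => by
      apply le_antisymm
      · refine le_of_tendsto_of_tendsto' (hlim (x + y)) ((hlim x).add (hlim y)) fun m => ?_
        rw [← map_add]
        exact map_mono hf (add_inf_le_inf_add_inf hx hy (nsmul_nonneg hu m))
      · refine le_of_tendsto' ((hlim x).add (hlim y)) fun m => ?_
        rw [← map_add]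
        refine (map_mono hf inf_add_inf_le_add_inf_add).trans ?_
        rw [← add_nsmul]
        exact le_ciSup (hbdd (x + y)) (m + m))
  exact ⟨g, fun x hx => by rw [hg x hx]; exact hlim x⟩

namespace IsComponent

variable {f g : StrongDual ℝ E} {u : E}

theorem nonneg (h : IsComponent f u g) (hf : 0 ≤ f) (hu : 0 ≤ u) : 0 ≤ g := fun x hx =>
  ge_of_tendsto' (h x hx) fun m => apply_nonneg hf (le_inf hx (nsmul_nonneg hu m))

theorem apply_self (h : IsComponent f u g) (hu : 0 ≤ u) : g u = f u := by
  refine tendsto_nhds_unique (h u hu) (tendsto_const_nhds.congr' ?_)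
  filter_upwards [eventually_ge_atTop 1] with m hm
  rw [inf_eq_left.2]
  simpa using nsmul_le_nsmul_left hu hm

theorem apply_of_disjoint (h : IsComponent f u g) (hu : 0 ≤ u) {v : E} (hv : 0 ≤ v)
    (huv : u ⊓ v = 0) : g v = 0 := by
  refine tendsto_nhds_unique (h v hv) (tendsto_const_nhds.congr fun m => ?_)
  rw [inf_comm, nsmul_inf_eq_zero hu hv huv, map_zero]

theorem apply_inf (h : IsComponent f u g) (hu : 0 ≤ u) {x : E} (hx : 0 ≤ x) (m : ℕ) :
    g (x ⊓ m • u) = f (x ⊓ m • u) := by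
  refine tendsto_nhds_unique (h _ (le_inf hx (nsmul_nonneg hu m)))
    (tendsto_const_nhds.congr' ?_)
  filter_upwards [eventually_ge_atTop m] with k hk
  rw [inf_assoc, inf_eq_left.2 (nsmul_le_nsmul_left hu hk)]

/-- Split `x` into `x ⊓ m • u` and the remainder: `g'` vanishes on the first piece, and `g` of the
second tends to zero with `m`. -/
theorem inf_eq_zero (h : IsComponent f u g) (hf : 0 ≤ f) (hu : 0 ≤ u) {g' : StrongDual ℝ E}
    {v : E} (h' : IsComponent f v g') (hv : 0 ≤ v) (huv : u ⊓ v = 0) : g ⊓ g' = 0 := by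
  have hg := h.nonneg hf hu
  have hg' := h'.nonneg hf hv
  refine le_antisymm (fun x hx => ?_) (le_inf hg hg')
  have key : ∀ m : ℕ, (g ⊓ g') x ≤ g x - f (x ⊓ m • u) := fun m => by
    have h0 : 0 ≤ x ⊓ m • u := le_inf hx (nsmul_nonneg hu m)
    have h1 : (g ⊓ g') (x - x ⊓ m • u) ≤ g (x - x ⊓ m • u) :=
      (inf_le_left : g ⊓ g' ≤ g) _ (sub_nonneg.2 inf_le_left)
    have h2 : (g ⊓ g') (x ⊓ m • u) ≤ g' (x ⊓ m • u) := (inf_le_right : g ⊓ g' ≤ g') _ h0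
    have h3 : g' (x ⊓ m • u) = 0 := h'.apply_of_disjoint hv h0
      (inf_eq_zero_of_le hv h0 le_rfl inf_le_right
        (by rw [inf_comm]; exact nsmul_inf_eq_zero hu hv huv m))
    rw [map_sub, map_sub, h.apply_inf hu hx] at h1
    linarith
  have := ge_of_tendsto' ((h x hx).const_sub (g x)) key
  simpa using this

/-- The components of `f` along a disjoint sequence add up to at most `f`. -/
theorem sum_le {u : ℕ → E} {g : ℕ → StrongDual ℝ E} (h : ∀ i, IsComponent f (u i) (g i))
    (hf : 0 ≤ f) (hu : ∀ i, 0 ≤ u i) (hd : ∀ i j, i ≠ j → u i ⊓ u j = 0) (N : ℕ) :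
    ∑ i ∈ Finset.range N, g i ≤ f := fun x hx => by
  rw [sum_apply]
  refine le_of_tendsto' (tendsto_finsetSum _ fun i _ => h i x hx) fun m => ?_
  rw [← map_sum]
  have h0 : ∀ i, 0 ≤ x ⊓ m • u i := fun i => le_inf hx (nsmul_nonneg (hu i) m)
  -- At a fixed level `m` the truncations `x ⊓ m • u i` are pairwise disjoint and below `x`, so
  -- their sum is below `x`.
  exact map_mono hf (sum_le_of_disjoint h0 hx (fun i j hij =>
    inf_eq_zero_of_le (h0 i) (h0 j) inf_le_right inf_le_right
      (nsmul_inf_nsmul_eq_zero (hu i) (hu j) (hd i j hij) m m)) (fun i => inf_le_left) N)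

end IsComponent

theorem summable_abs_apply {f : StrongDual ℝ E} {g : ℕ → StrongDual ℝ E} (hg : ∀ i, 0 ≤ g i)
    (hgf : ∀ N, ∑ i ∈ Finset.range N, g i ≤ f) (x : E) : Summable fun i => |g i x| := by
  refine summable_of_sum_range_le (c := f |x|) (fun i => abs_nonneg _) fun N => ?_
  have := hgf N |x| (abs_nonneg x)
  rw [sum_apply] at this
  exact (Finset.sum_le_sum fun i _ => abs_map_le (hg i) x).trans this

/-- The functional `x ↦ ∑ i, s i * g i x` for bounded `s` and positive `g i` with partial sums
bounded by `f`. -/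
theorem exists_weighted_sum {f : StrongDual ℝ E} {g : ℕ → StrongDual ℝ E} (hg : ∀ i, 0 ≤ g i)
    (hgf : ∀ N, ∑ i ∈ Finset.range N, g i ≤ f) (s : ℕ → ℝ) (hs : ∀ i, |s i| ≤ 1) :
    ∃ ψ : StrongDual ℝ E, ∀ x, ψ x = ∑' i, s i * g i x := by
  have hsum : ∀ x, Summable fun i => |s i * g i x| := fun x =>
    (summable_abs_apply hg hgf x).of_nonneg_of_le (fun i => abs_nonneg _) fun i => by
      rw [abs_mul]
      exact mul_le_of_le_one_left (abs_nonneg _) (hs i)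
  have hadd : ∀ x y, ∑' i, s i * g i (x + y) = ∑' i, s i * g i x + ∑' i, s i * g i y :=
    fun x y => by
      rw [← (hsum x).of_abs.tsum_add (hsum y).of_abs]
      exact tsum_congr fun i => by rw [map_add, mul_add]
  have hsmul : ∀ (c : ℝ) (x : E), ∑' i, s i * g i (c • x) = c * ∑' i, s i * g i x :=
    fun c x => by
      rw [← tsum_mul_left]
      exact tsum_congr fun i => by rw [map_smul, smul_eq_mul]; ring
  have hbound : ∀ x, ‖∑' i, s i * g i x‖ ≤ ‖f‖ * ‖x‖ := fun x => by
    have h3 : Summable fun i => ‖s i * g i x‖ := by simpa only [Real.norm_eq_abs] using hsum x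
    refine (norm_tsum_le_tsum_norm h3).trans (h3.tsum_le_of_sum_range_le fun N => ?_)
    have h1 := hgf N |x| (abs_nonneg x)
    rw [sum_apply] at h1
    have h2 : f |x| ≤ ‖f‖ * ‖x‖ := by
      have := apply_le f (abs_nonneg x) le_rfl
      rwa [norm_abs_eq_norm] at this
    refine (Finset.sum_le_sum fun i _ => ?_).trans (h1.trans h2)
    rw [Real.norm_eq_abs, abs_mul]
    exact (mul_le_of_le_one_left (abs_nonneg _) (hs i)).trans (abs_map_le (hg i) x)
  let L : E →ₗ[ℝ] ℝ := IsLinearMap.mk' (fun x => ∑' i, s i * g i x) ⟨hadd, hsmul⟩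
  exact ⟨L.mkContinuous ‖f‖ hbound, fun x => rfl⟩

end Functional

/-! ### Extracting disjoint sequences from pointwise null functionals -/

section Disjointification

variable {E : Type*} [NormedAddCommGroup E] [NormedSpace ℝ E] [Lattice E]
  [IsOrderedAddMonoid E] [HasSolidNorm E]

theorem exists_nonneg_lt_apply {f : StrongDual ℝ E} (hf : 0 ≤ f) {r : ℝ} (hr : r < ‖f‖) :
    ∃ x : E, 0 ≤ x ∧ ‖x‖ ≤ 1 ∧ r < f x := by
  obtain ⟨x, hx, hrx⟩ := f.exists_lt_apply_of_lt_opNorm hr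
  exact ⟨|x|, abs_nonneg x, by rw [norm_abs_eq_norm]; exact hx.le,
    hrx.trans_le (abs_map_le hf x)⟩

variable [IsOrderedModule ℝ E]

/-- With `e = c • b - a`, the element `b - d • a` is at most `c⁻¹ • e`. Thus the second positive
part lies below a multiple of `e⁺`, which is disjoint from `(-e)⁺`. -/
theorem posPart_sub_smul_inf_eq_zero {a b : E} {c d : ℝ} (ha : 0 ≤ a) (hc : 0 < c)
    (hcd : 1 ≤ c * d) : (a - c • b)⁺ ⊓ (b - d • a)⁺ = 0 := by
  obtain ⟨m, hm⟩ := exists_nat_ge c⁻¹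
  set e : E := -(a - c • b) with he
  have hd : c⁻¹ ≤ d := by
    rw [inv_le_iff_one_le_mul₀ hc, mul_comm]; exact hcd
  have h1 : b - d • a ≤ m • e⁺ := by
    calc b - d • a ≤ b - c⁻¹ • a := sub_le_sub_left (smul_le_smul_of_nonneg_right hd ha) b
      _ = c⁻¹ • e := by
        rw [he, neg_sub, smul_sub, smul_smul, inv_mul_cancel₀ hc.ne', one_smul]
      _ ≤ c⁻¹ • e⁺ := smul_le_smul_of_nonneg_left (le_posPart e) (inv_nonneg.2 hc.le)
      _ ≤ (m : ℝ) • e⁺ := smul_le_smul_of_nonneg_right hm (posPart_nonneg e)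
      _ = m • e⁺ := Nat.cast_smul_eq_nsmul ℝ m _
  have h2 : (b - d • a)⁺ ≤ m • e⁺ := sup_le h1 (nsmul_nonneg (posPart_nonneg e) m)
  refine inf_eq_zero_of_le (posPart_nonneg _) (posPart_nonneg _) le_rfl h2 ?_
  rw [inf_comm]
  refine nsmul_inf_eq_zero (posPart_nonneg e) (posPart_nonneg _) ?_ m
  rw [inf_comm]
  exact posPart_inf_posPart_neg _

variable [CompleteSpace E]

/-- From near-norming vectors, subtract a large multiple of the earlier ones, on which `f n` is
small for late `n`, and a small multiple of a weighted sum of all the chosen ones. The positive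
parts of what is left are disjoint, and at most half of `δ` is lost. -/
theorem exists_disjoint_of_le_norm {f : ℕ → StrongDual ℝ E} (hf : ∀ n, 0 ≤ f n)
    (h0 : ∀ x, Tendsto (fun n => f n x) atTop (𝓝 0)) {δ : ℝ} (hδ : 0 < δ)
    (hn : ∀ n, δ < ‖f n‖) :
    ∃ φ : ℕ → ℕ, StrictMono φ ∧ ∃ u : ℕ → E, (∀ k, 0 ≤ u k) ∧ (∀ k, ‖u k‖ ≤ 1) ∧
      (∀ i j, i ≠ j → u i ⊓ u j = 0) ∧ ∀ k, δ / 2 ≤ f (φ k) (u k) := by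
  obtain ⟨C, hC⟩ := banach_steinhaus (g := f) fun x => by
    obtain ⟨B, hB⟩ := (h0 x).norm.bddAbove_range
    exact ⟨B, fun n => hB ⟨n, rfl⟩⟩
  have hCpos : 0 < C := hδ.trans ((hn 0).trans_le (hC 0))
  choose x hx0 hx1 hfx using fun n => exists_nonneg_lt_apply (hf n) (hn n)
  -- Chosen so that `β * f n w ≤ δ / 4` for the vector `w` below, which has norm at most `2`.
  set β : ℝ := δ / (8 * C) with hβdef
  have hβ : 0 < β := by positivity
  have hβC : β * (2 * C) = δ / 4 := by rw [hβdef]; field_simp; norm_num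
  set a : ℕ → E := fun m => ∑ i ∈ Finset.range (m + 1), x i with ha
  have hxa : ∀ i m, i ≤ m → x i ≤ a m := fun i m h =>
    Finset.single_le_sum (fun j _ => hx0 j) (Finset.mem_range.2 (by omega))
  have ha0 : ∀ m, 0 ≤ a m := fun m => Finset.sum_nonneg fun j _ => hx0 j
  have hnext : ∀ m, ∃ n, m < n ∧ f n ((4 ^ (m + 1) / β) • a m) < δ / 4 := fun m =>
    ((eventually_gt_atTop m).and ((h0 _).eventually_lt_const (by positivity))).exists
  choose g hg hgf using hnext
  let φ : ℕ → ℕ := fun k => Nat.rec 0 (fun _ m => g m) k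
  have hφ : StrictMono φ := strictMono_nat_of_lt_succ fun k => hg (φ k)
  -- The shift by one leaves room to subtract `a (φ k)`, which dominates every `z j` with `j < k`.
  set z : ℕ → E := fun k => x (φ (k + 1)) with hz
  have hnorm : ∀ k, ‖((1 / 2 : ℝ) ^ k) • z k‖ ≤ (1 / 2 : ℝ) ^ k := fun k => by
    rw [norm_smul, Real.norm_of_nonneg (by positivity)]
    exact mul_le_of_le_one_right (by positivity) (hx1 _)
  have hsum : Summable fun k => ((1 / 2 : ℝ) ^ k) • z k :=
    Summable.of_norm_bounded summable_geometric_two hnorm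
  set w : E := ∑' k, ((1 / 2 : ℝ) ^ k) • z k with hw
  have hwn : ‖w‖ ≤ 2 := tsum_of_norm_bounded hasSum_geometric_two hnorm
  have hzw : ∀ k, ((1 / 2 : ℝ) ^ k) • z k ≤ w := fun k =>
    hsum.le_tsum k fun j _ => smul_nonneg (by positivity) (hx0 _)
  have hw0 : 0 ≤ w := (smul_nonneg (by positivity) (hx0 _)).trans (hzw 0)
  set v : ℕ → E := fun k =>
    z k - ((4 ^ (φ k + 1) / β) • a (φ k) + (β * (1 / 2) ^ k) • w) with hv
  have hA : ∀ k, 0 ≤ (4 ^ (φ k + 1) / β : ℝ) • a (φ k) := fun k =>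
    smul_nonneg (by positivity) (ha0 _)
  have hB : ∀ k, 0 ≤ (β * (1 / 2) ^ k : ℝ) • w := fun k => smul_nonneg (by positivity) hw0
  have hvz : ∀ k, (v k)⁺ ≤ z k := fun k =>
    sup_le (sub_le_self _ (add_nonneg (hA k) (hB k))) (hx0 _)
  have hdisj : ∀ j k, j < k → (v j)⁺ ⊓ (v k)⁺ = 0 := fun j k hjk => by
    have h1 : (v j)⁺ ≤ (z j - (β * (1 / 2) ^ j * (1 / 2) ^ k) • z k)⁺ := by
      refine posPart_mono (sub_le_sub_left ?_ _)
      refine le_trans ?_ (le_add_of_nonneg_left (hA j))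
      rw [mul_smul]
      exact smul_le_smul_of_nonneg_left (hzw k) (by positivity)
    have h2 : (v k)⁺ ≤ (z k - (4 ^ (φ k + 1) / β) • z j)⁺ := by
      refine posPart_mono (sub_le_sub_left ?_ _)
      refine le_trans ?_ (le_add_of_nonneg_right (hB k))
      exact smul_le_smul_of_nonneg_left (hxa _ _ (hφ.monotone hjk)) (by positivity)
    refine inf_eq_zero_of_le (posPart_nonneg _) (posPart_nonneg _) h1 h2
      (posPart_sub_smul_inf_eq_zero (hx0 _) (by positivity) ?_)
    -- The two coefficients multiply to `4 ^ (φ k + 1) / 2 ^ (j + k)`, which is at least `1` because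
    -- `j < k ≤ φ k`.
    have h3 : k ≤ φ k := hφ.id_le k
    have h4 : (2 : ℝ) ^ (j + k) ≤ 4 ^ (φ k + 1) := by
      rw [show (4 : ℝ) = 2 ^ 2 by norm_num, ← pow_mul]
      exact pow_le_pow_right₀ (by norm_num) (by omega)
    have h5 : β * (1 / 2) ^ j * (1 / 2) ^ k * (4 ^ (φ k + 1) / β)
        = 4 ^ (φ k + 1) / 2 ^ (j + k) := by
      rw [one_div, inv_pow, inv_pow]; field_simp; rw [pow_add]
    rw [h5]
    exact (one_le_div (by positivity)).2 h4
  refine ⟨fun k => φ (k + 1), fun i j h => hφ (Nat.succ_lt_succ h), fun k => (v k)⁺,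
    fun k => posPart_nonneg _, fun k => (norm_le_of_le (posPart_nonneg _) (hvz k)).trans (hx1 _),
    fun i j hij => ?_, fun k => ?_⟩
  · rcases lt_or_gt_of_ne hij with h | h
    · exact hdisj i j h
    · rw [inf_comm]; exact hdisj j i h
  · have h1 : f (φ (k + 1)) (v k) ≤ f (φ (k + 1)) (v k)⁺ := map_mono (hf _) (le_posPart _)
    have h2 : f (φ (k + 1)) ((4 ^ (φ k + 1) / β) • a (φ k)) < δ / 4 := hgf (φ k)
    have h3 : f (φ (k + 1)) w ≤ 2 * C := by
      refine (le_abs_self _).trans (((f _).le_opNorm w).trans ?_)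
      rw [mul_comm 2 C]
      exact mul_le_mul (hC _) hwn (norm_nonneg _) hCpos.le
    have h4 : (1 / 2 : ℝ) ^ k ≤ 1 := pow_le_one₀ (by norm_num) (by norm_num)
    have h5 : β * (1 / 2) ^ k * f (φ (k + 1)) w ≤ β * (2 * C) := by
      have := apply_nonneg (hf (φ (k + 1))) hw0
      calc _ ≤ β * 1 * f (φ (k + 1)) w := by gcongr
        _ ≤ _ := by rw [mul_one]; gcongr
    have h6 := hfx (φ (k + 1))
    have h7 : f (φ (k + 1)) (v k) = f (φ (k + 1)) (x (φ (k + 1)))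
        - (f (φ (k + 1)) ((4 ^ (φ k + 1) / β) • a (φ k)) + β * (1 / 2) ^ k * f (φ (k + 1)) w) := by
      rw [hv]
      simp only [map_sub, map_add, map_smul, smul_eq_mul, hz]
    linarith

/-- If positive functionals converge pointwise but not in norm to zero, this is witnessed, along
a subsequence, by a disjoint positive sequence in the unit ball. -/
theorem exists_disjoint_of_not_tendsto {f : ℕ → StrongDual ℝ E} (hf : ∀ n, 0 ≤ f n)
    (h0 : ∀ x, Tendsto (fun n => f n x) atTop (𝓝 0))
    (hn : ¬ Tendsto (fun n => ‖f n‖) atTop (𝓝 0)) :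
    ∃ δ : ℝ, 0 < δ ∧ ∃ φ : ℕ → ℕ, StrictMono φ ∧ ∃ u : ℕ → E, (∀ k, 0 ≤ u k) ∧
      (∀ k, ‖u k‖ ≤ 1) ∧ (∀ i j, i ≠ j → u i ⊓ u j = 0) ∧ ∀ k, δ ≤ f (φ k) (u k) := by
  have : ∃ δ : ℝ, 0 < δ ∧ ∃ᶠ n in atTop, δ < ‖f n‖ := by
    by_contra! hcon
    refine hn (tendsto_order.2 ⟨fun a ha => Eventually.of_forall fun n =>
      ha.trans_le (norm_nonneg _), fun a ha => ?_⟩)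
    filter_upwards [hcon (a / 2) (by positivity)] with n hn
    linarith
  obtain ⟨δ, hδ, hfreq⟩ := this
  obtain ⟨ψ, hψ, hψδ⟩ := extraction_of_frequently_atTop hfreq
  obtain ⟨φ, hφ, u, h1, h2, h3, h4⟩ := exists_disjoint_of_le_norm (fun n => hf (ψ n))
    (fun x => (h0 x).comp hψ.tendsto_atTop) hδ hψδ
  exact ⟨δ / 2, by positivity, ψ ∘ φ, hψ.comp hφ, u, h1, h2, h3, h4⟩

end Disjointification

/-! ### Order continuity of the dual norm and disjoint sequences -/

section OrderContinuity

variable {E : Type*} [NormedAddCommGroup E] [NormedSpace ℝ E] [Lattice E]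
  [IsOrderedAddMonoid E] [HasSolidNorm E]

/-- Order continuity is applied to the differences between upper bounds of the partial sums and the
partial sums themselves, so no supremum of the series is needed. A small difference `h - s n`
dominates the term `g n`. -/
theorem tendsto_norm_of_sum_le (hE : OrderContinuousNorm (StrongDual ℝ E))
    {f : StrongDual ℝ E} {g : ℕ → StrongDual ℝ E} (hg : ∀ i, 0 ≤ g i)
    (hgf : ∀ N, ∑ i ∈ Finset.range N, g i ≤ f) : Tendsto (fun n => ‖g n‖) atTop (𝓝 0) := by
  set s : ℕ → StrongDual ℝ E := fun N => ∑ i ∈ Finset.range N, g i with hs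
  have hsmono : Monotone s := monotone_nat_of_le_succ fun n => by
    simp only [hs, Finset.sum_range_succ]
    exact le_add_of_nonneg_right (hg n)
  let D : Set (StrongDual ℝ E) := {d | ∃ h N, (∀ n, s n ≤ h) ∧ d = h - s N}
  have hD0 : ∀ d ∈ D, 0 ≤ d := by
    rintro _ ⟨h, N, hh, rfl⟩
    exact sub_nonneg.2 (hh N)
  have hDdir : DirectedOn (fun a b => b ≤ a) D := by
    rintro _ ⟨h, N, hh, rfl⟩ _ ⟨h', N', hh', rfl⟩
    refine ⟨h ⊓ h' - s (max N N'), ⟨_, _, fun n => le_inf (hh n) (hh' n), rfl⟩, ?_, ?_⟩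
    · exact sub_le_sub inf_le_left (hsmono (le_max_left _ _))
    · exact sub_le_sub inf_le_right (hsmono (le_max_right _ _))
  have hDglb : IsGLB D 0 := by
    refine ⟨fun d hd => hD0 d hd, fun c hc => ?_⟩
    -- A lower bound `c` of `D` can be subtracted from any upper bound of the partial sums.
    -- Repeating this from `f` gives `k • c ≤ f` for all `k`, which forces `c ≤ 0`.
    have hk : ∀ k : ℕ, ∀ n, s n ≤ f - k • c := fun k => by
      induction k with
      | zero => simpa using hgf
      | succ k ih =>
        intro n
        have := hc ⟨_, n, ih, rfl⟩
        rw [succ_nsmul, ← sub_sub]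
        exact le_sub_comm.1 this
    intro x hx
    by_contra! hcx
    obtain ⟨k, hk'⟩ := exists_nat_gt (f x / c x)
    have h1 := hk k 0 x hx
    have h2 : s 0 = 0 := by simp [hs]
    rw [h2, sub_apply, zero_apply, smul_apply, nsmul_eq_mul] at h1
    rw [zero_apply] at hcx
    rw [div_lt_iff₀ hcx] at hk'
    linarith
  rw [tendsto_order]
  refine ⟨fun a ha => Eventually.of_forall fun n => ha.trans_le (norm_nonneg _), fun a ha => ?_⟩
  obtain ⟨_, ⟨h, N, hh, rfl⟩, hN⟩ := hE D ⟨_, f, 0, hgf, rfl⟩ hDdir hDglb a ha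
  filter_upwards [eventually_ge_atTop N] with n hn
  refine (norm_le_of_le (hg n) ?_).trans_lt
    (hN (h - s n) ⟨h, n, hh, rfl⟩ (sub_le_sub_left (hsmono hn) h))
  have h1 := hh (n + 1)
  simp only [hs, Finset.sum_range_succ] at h1 ⊢
  exact le_sub_iff_add_le'.2 h1

/-- If the dual norm is order continuous, bounded disjoint positive sequences are weakly null. -/
theorem tendsto_apply_of_disjoint (hE : OrderContinuousNorm (StrongDual ℝ E))
    {f : StrongDual ℝ E} (hf : 0 ≤ f) {u : ℕ → E} (hu : ∀ k, 0 ≤ u k) (hu1 : ∀ k, ‖u k‖ ≤ 1)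
    (hd : ∀ i j, i ≠ j → u i ⊓ u j = 0) : Tendsto (fun k => f (u k)) atTop (𝓝 0) := by
  choose g hg using fun k => exists_isComponent hf (hu k)
  -- Here `f (u k) = g k (u k) ≤ ‖g k‖`, and the components `g k` have partial sums below `f`.
  refine squeeze_zero (fun k => apply_nonneg hf (hu k)) (fun k => ?_)
    (tendsto_norm_of_sum_le hE (fun i => (hg i).nonneg hf (hu i))
      (IsComponent.sum_le hg hf hu hd))
  rw [← (hg k).apply_self (hu k)]
  exact (le_abs_self _).trans (((g k).le_opNorm _).trans
    (mul_le_of_le_one_right (norm_nonneg _) (hu1 k)))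

theorem weaklyNull_of_disjoint (hE : OrderContinuousNorm (StrongDual ℝ E))
    {u : ℕ → E} (hu : ∀ k, 0 ≤ u k) (hu1 : ∀ k, ‖u k‖ ≤ 1)
    (hd : ∀ i j, i ≠ j → u i ⊓ u j = 0) : WeaklyNull u := fun f => by
  refine squeeze_zero_norm (fun k => ?_)
    (tendsto_apply_of_disjoint hE (abs_nonneg f) hu hu1 hd)
  have := abs_apply_le f (u k)
  rwa [abs_of_nonneg (hu k)] at this

/-- If the dual norm is not order continuous, some order bounded positive series in the dual has
terms bounded away from zero. -/
theorem exists_sum_le_of_not_orderContinuousNorm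
    (hE : ¬ OrderContinuousNorm (StrongDual ℝ E)) :
    ∃ (f : StrongDual ℝ E) (g : ℕ → StrongDual ℝ E), (∀ i, 0 ≤ g i) ∧
      (∀ N, ∑ i ∈ Finset.range N, g i ≤ f) ∧ ∃ ε : ℝ, 0 < ε ∧ ∀ n, ε ≤ ‖g n‖ := by
  simp only [OrderContinuousNorm, not_forall, not_exists, not_and, not_lt] at hE
  obtain ⟨D, ⟨e, he⟩, hdir, hglb, ε, hε, hD⟩ := hE
  have hD0 : ∀ d ∈ D, 0 ≤ d := fun d hd => hglb.1 hd
  -- Otherwise elements `d k` below which `D` varies by less than `1 / (k + 1)` form a Cauchy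
  -- sequence. Its limit is a positive lower bound of `D`, hence zero, against the norms in `D` that
  -- stay above `ε`.
  have hgap : ∃ η : ℝ, 0 < η ∧ ∀ d ∈ D, ∃ x ∈ D, x ≤ d ∧ η ≤ ‖d - x‖ := by
    by_contra! hcon
    choose d hdD hd using fun k : ℕ => hcon (1 / (k + 1)) (by positivity)
    have hlim := tendsto_one_div_add_atTop_nhds_zero_nat (𝕜 := ℝ)
    have hcauchy : CauchySeq d := by
      rw [Metric.cauchySeq_iff']
      intro r hr
      obtain ⟨N, hN⟩ := (hlim.eventually_lt_const (half_pos hr)).exists_forall_of_atTop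
      refine ⟨N, fun n hn => ?_⟩
      obtain ⟨z, hz, hzn, hzN⟩ := hdir _ (hdD n) _ (hdD N)
      have h1 := hd n z hz hzn
      have h2 := hd N z hz hzN
      have h3 := hN n hn
      have h4 := hN N le_rfl
      rw [dist_eq_norm, ← sub_sub_sub_cancel_right (d n) (d N) z]
      exact (norm_sub_le _ _).trans_lt (by linarith)
    obtain ⟨l, hl⟩ := cauchySeq_tendsto_of_complete hcauchy
    have hl0 : l ≤ 0 := hglb.2 fun e he => by
      choose z hz hze hzd using fun k => hdir _ he _ (hdD k)
      have hzl : Tendsto z atTop (𝓝 l) := by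
        have h1 : Tendsto (fun k => d k - z k) atTop (𝓝 0) :=
          squeeze_zero_norm (fun k => (hd k _ (hz k) (hzd k)).le) hlim
        simpa using hl.sub h1
      exact le_of_tendsto' hzl hze
    have hl0' : 0 ≤ l := ge_of_tendsto' hl fun k => hD0 _ (hdD k)
    rw [le_antisymm hl0 hl0'] at hl
    obtain ⟨k, hk⟩ := (hl.norm.eventually_lt_const (by simpa using hε)).exists
    obtain ⟨x, hx, hxd, hεx⟩ := hD _ (hdD k)
    exact absurd (norm_le_of_le (hD0 x hx) hxd) (by linarith)
  obtain ⟨η, hη, hgap⟩ := hgap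
  choose nxt hmem hle hnorm using hgap
  -- Iterating the gap from `e` gives a decreasing sequence; its consecutive differences telescope
  -- to at most `e`.
  let d : ℕ → D := fun k => Nat.rec ⟨e, he⟩ (fun _ z => ⟨nxt z.1 z.2, hmem z.1 z.2⟩) k
  refine ⟨e, fun k => (d k).1 - (d (k + 1)).1, fun k => ?_, fun N => ?_, η, hη, fun k => ?_⟩
  · exact sub_nonneg.2 (hle _ _)
  · rw [Finset.sum_range_sub']
    exact sub_le_self _ (hD0 _ (d N).2)
  · exact hnorm _ _

/-- If the dual norm is not order continuous, some positive functional is bounded away from zero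
on a disjoint positive sequence in the unit ball. -/
theorem exists_disjoint_of_not_orderContinuousNorm [IsOrderedModule ℝ E] [CompleteSpace E]
    (hE : ¬ OrderContinuousNorm (StrongDual ℝ E)) :
    ∃ f : StrongDual ℝ E, 0 ≤ f ∧ ∃ δ : ℝ, 0 < δ ∧ ∃ u : ℕ → E, (∀ k, 0 ≤ u k) ∧
      (∀ k, ‖u k‖ ≤ 1) ∧ (∀ i j, i ≠ j → u i ⊓ u j = 0) ∧ ∀ k, δ ≤ f (u k) := by
  obtain ⟨f, g, hg, hgf, ε, hε, hεg⟩ := exists_sum_le_of_not_orderContinuousNorm hE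
  have h0 : ∀ x, Tendsto (fun n => g n x) atTop (𝓝 0) := fun x =>
    (tendsto_zero_iff_abs_tendsto_zero _).2 (summable_abs_apply hg hgf x).tendsto_atTop_zero
  obtain ⟨δ, hδ, φ, -, u, hu, hu1, hd, hδu⟩ := exists_disjoint_of_not_tendsto hg h0 fun h => by
    obtain ⟨n, hn⟩ := (h.eventually_lt_const hε).exists
    exact absurd (hεg n) (by linarith)
  have hf0 : 0 ≤ f := by simpa using hgf 0
  refine ⟨f, hf0, δ, hδ, u, hu, hu1, hd, fun k => (hδu k).trans ?_⟩
  exact (Finset.single_le_sum (fun j _ => hg j) (Finset.self_mem_range_succ (φ k))).trans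
    (hgf _) (u k) (hu k)

end OrderContinuity

/-- The Schur property of `ℓ¹`, for rows `b n` tested against all choices of signs. -/
theorem tendsto_tsum_abs_of_signs {b : ℕ → ℕ → ℝ} (hb : ∀ n, Summable fun k => |b n k|)
    (hcoord : ∀ k, Tendsto (fun n => b n k) atTop (𝓝 0))
    (h : ∀ s : ℕ → Bool, Tendsto (fun n => ∑' k, (if s k then 1 else -1) * b n k) atTop (𝓝 0)) :
    Tendsto (fun n => ∑' k, |b n k|) atTop (𝓝 0) := by
  have habs : ∀ (n k : ℕ) (t : Bool), |(if t then 1 else -1) * b n k| = |b n k| := by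
    intro n k t; cases t <;> simp
  have hcont : ∀ n, Continuous fun s : ℕ → Bool => ∑' k, (if s k then 1 else -1) * b n k :=
    fun n => continuous_tsum
      (fun k => ((continuous_of_discreteTopology (f := fun t : Bool =>
        (if t then (1 : ℝ) else -1))).comp (continuous_apply k)).mul continuous_const)
      (hb n) fun k s => (habs n k (s k)).le
  have hsum : ∀ (n : ℕ) (s : ℕ → Bool), Summable fun k => (if s k then 1 else -1) * b n k :=
    fun n s => Summable.of_abs (by simpa only [habs] using hb n)
  rw [tendsto_order]
  refine ⟨fun a ha => Eventually.of_forall fun n =>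
    ha.trans_le (tsum_nonneg fun k => abs_nonneg _), fun a ha => ?_⟩
  -- Baire category on the Cantor space of signs: some `A N` has interior, hence contains all sign
  -- patterns that agree with one `s₀` on a finite set `I`.
  let A : ℕ → Set (ℕ → Bool) := fun N =>
    ⋂ n ∈ Set.Ici N, {s | |∑' k, (if s k then 1 else -1) * b n k| ≤ a / 3}
  have hA : ∀ N, IsClosed (A N) := fun N =>
    isClosed_biInter fun n _ => isClosed_le (hcont n).abs continuous_const
  have hU : ⋃ N, A N = Set.univ := Set.eq_univ_of_forall fun s => by
    obtain ⟨N, hN⟩ := ((h s).abs.eventually_lt_const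
      (show |(0 : ℝ)| < a / 3 by rw [abs_zero]; positivity)).exists_forall_of_atTop
    exact Set.mem_iUnion.2 ⟨N, Set.mem_iInter₂.2 fun n hn => (hN n hn).le⟩
  obtain ⟨N, s₀, hs₀⟩ := nonempty_interior_of_iUnion_of_closed hA hU
  obtain ⟨I, u, hu, hIu⟩ := isOpen_pi_iff.1 isOpen_interior s₀ hs₀
  have hmem : ∀ s : ℕ → Bool, (∀ k ∈ I, s k = s₀ k) → ∀ n, N ≤ n →
      |∑' k, (if s k then 1 else -1) * b n k| ≤ a / 3 := fun s hs n hn =>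
    Set.mem_iInter₂.1 (interior_subset (hIu fun k hk => by
      rw [hs k hk]; exact (hu k hk).2)) n hn
  have hI : Tendsto (fun n => ∑ k ∈ I, |b n k|) atTop (𝓝 0) := by
    simpa using tendsto_finsetSum I fun k _ => (hcoord k).abs
  filter_upwards [eventually_ge_atTop N, hI.eventually_lt_const (show 0 < a / 3 by positivity)]
    with n hn hnI
  -- The patterns `t` and `t'` agree on `I` and are opposite elsewhere, so half the difference of
  -- their sums is `∑ |b n k|` over `k ∉ I`, at most `a / 3`. Coordinatewise convergence handles
  -- `I`.
  let t : ℕ → Bool := fun k => if k ∈ I then s₀ k else decide (0 ≤ b n k)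
  let t' : ℕ → Bool := fun k => if k ∈ I then s₀ k else !decide (0 ≤ b n k)
  have ht := abs_le.1 (hmem t (fun k hk => if_pos hk) n hn)
  have ht' := abs_le.1 (hmem t' (fun k hk => if_pos hk) n hn)
  have hdiff := ((hsum n t).sub (hsum n t')).mul_left (1 / 2)
  have hkey : ∑' k, |b n k| - 1 / 2 * (∑' k, (if t k then 1 else -1) * b n k
      - ∑' k, (if t' k then 1 else -1) * b n k) = ∑ k ∈ I, |b n k| := by
    rw [← (hsum n t).tsum_sub (hsum n t'), ← tsum_mul_left, ← (hb n).tsum_sub hdiff,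
      tsum_eq_sum (s := I)]
    · refine Finset.sum_congr rfl fun k hk => ?_
      simp [t, t', hk]
    · intro k hk
      by_cases h0 : 0 ≤ b n k
      · simp [t, t', hk, h0, abs_of_nonneg h0]; ring
      · simp [t, t', hk, h0, abs_of_neg (not_le.1 h0)]; ring
  linarith [ht.1, ht.2, ht'.1, ht'.2]

/-! ### Weakly null and weakly `p`-summable sequences -/

section WeaklyPSummable

variable {X : Type*} [NormedAddCommGroup X] [NormedSpace ℝ X] {p : ℝ} {x : ℕ → X}

theorem tendsto_zero_of_summable_rpow {a : ℕ → ℝ} (hp : 0 < p)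
    (h : Summable fun n => |a n| ^ p) : Tendsto a atTop (𝓝 0) := by
  rw [tendsto_zero_iff_abs_tendsto_zero]
  have := h.tendsto_atTop_zero.rpow_const (p := p⁻¹) (Or.inr (inv_nonneg.2 hp.le))
  rw [Real.zero_rpow (inv_ne_zero hp.ne')] at this
  exact this.congr fun n => Real.rpow_rpow_inv (abs_nonneg _) hp.ne'

theorem summable_rpow_of_summable_abs {a : ℕ → ℝ} (hp : 1 ≤ p) (h : Summable fun n => |a n|) :
    Summable fun n => |a n| ^ p := by
  refine h.of_norm_bounded_eventually_nat ?_
  filter_upwards [h.tendsto_atTop_zero.eventually_lt_const one_pos] with n hn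
  rw [Real.norm_of_nonneg (by positivity)]
  exact Real.rpow_le_self_of_le_one (abs_nonneg _) hn.le hp

theorem WeaklyPSummable.weaklyNull (hp : 0 < p) (h : WeaklyPSummable p x) : WeaklyNull x :=
  fun φ => tendsto_zero_of_summable_rpow hp (h φ)

theorem WeaklyNull.exists_norm_le (h : WeaklyNull x) : ∃ C, ∀ n, ‖x n‖ ≤ C := by
  obtain ⟨C, hC⟩ := banach_steinhaus
    (g := fun n => NormedSpace.inclusionInDoubleDual ℝ X (x n)) fun φ => by
      obtain ⟨B, hB⟩ := (h φ).norm.bddAbove_range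
      exact ⟨B, fun n => hB ⟨n, rfl⟩⟩
  refine ⟨C, fun n => ?_⟩
  have := hC n
  rwa [show ‖NormedSpace.inclusionInDoubleDual ℝ X (x n)‖ = ‖x n‖ from
    (NormedSpace.inclusionInDoubleDualLi ℝ).norm_map (x n)] at this

theorem WeaklyPSummable.comp (h : WeaklyPSummable p x) {φ : ℕ → ℕ} (hφ : StrictMono φ) :
    WeaklyPSummable p (x ∘ φ) := fun f => (h f).comp_injective hφ.injective

theorem WeaklyPSummable.neg (h : WeaklyPSummable p x) : WeaklyPSummable p fun n => -x n :=
  fun f => by simpa using h f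

end WeaklyPSummable

/-! ### Positive parts, the Schur argument and the two implications -/

section BanachLattice

variable {E : Type*} [NormedAddCommGroup E] [NormedSpace ℝ E] [Lattice E]
  [IsOrderedAddMonoid E] [HasSolidNorm E] {p : ℝ}

theorem DisjointSeq.neg {x : ℕ → E} (h : DisjointSeq x) : DisjointSeq fun n => -x n :=
  fun m n hmn => by simpa using h m n hmn

theorem DisjointSeq.posPart {x : ℕ → E} (h : DisjointSeq x) : DisjointSeq fun n => (x n)⁺ :=
  fun m n hmn => by
    rw [abs_of_nonneg (posPart_nonneg _), abs_of_nonneg (posPart_nonneg _)]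
    exact inf_eq_zero_of_le (posPart_nonneg _) (posPart_nonneg _)
      (sup_le (le_abs_self _) (abs_nonneg _)) (sup_le (le_abs_self _) (abs_nonneg _)) (h m n hmn)

/-- The positive parts of a disjoint weakly `p`-summable sequence are weakly `p`-summable. -/
theorem WeaklyPSummable.posPart (hp : 0 ≤ p) {x : ℕ → E} (hx : WeaklyPSummable p x)
    (hd : DisjointSeq x) : WeaklyPSummable p fun n => (x n)⁺ := fun φ => by
  have hφ := abs_nonneg φ
  have hle : ∀ n, (x n)⁺ ≤ |x n| := fun n => sup_le (le_abs_self _) (abs_nonneg _)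
  have hle' : ∀ n, (x n)⁻ ≤ |x n| := fun n => sup_le (neg_le_abs _) (abs_nonneg _)
  -- The components of `|φ|` along the `(x k)⁺` sum to one functional `ψ` with `ψ (x n) = |φ| (x
  -- n)⁺`: by disjointness, `g i` kills `(x n)⁻` for all `n` and `(x n)⁺` for `n ≠ i`.
  choose g hg using fun k => exists_isComponent hφ (posPart_nonneg (x k))
  have hg0 := fun i => (hg i).nonneg hφ (posPart_nonneg (x i))
  have hgφ := IsComponent.sum_le hg hφ (fun i => posPart_nonneg (x i)) fun i j hij =>
    inf_eq_zero_of_le (posPart_nonneg _) (posPart_nonneg _) (hle i) (hle j) (hd i j hij)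
  obtain ⟨ψ, hψ⟩ := exists_weighted_sum hg0 hgφ (fun _ => 1) (by simp)
  have key : ∀ n, ψ (x n) = |φ| (x n)⁺ := fun n => by
    rw [hψ, tsum_eq_single n]
    · rw [one_mul, ← posPart_sub_negPart (x n), map_sub, posPart_sub_negPart,
        (hg n).apply_self (posPart_nonneg _),
        (hg n).apply_of_disjoint (posPart_nonneg _) (negPart_nonneg _)
          (posPart_inf_negPart_eq_zero _), sub_zero]
    · intro i hi
      rw [one_mul, ← posPart_sub_negPart (x n), map_sub,
        (hg i).apply_of_disjoint (posPart_nonneg _) (posPart_nonneg _)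
          (inf_eq_zero_of_le (posPart_nonneg _) (posPart_nonneg _) (hle i) (hle n) (hd i n hi)),
        (hg i).apply_of_disjoint (posPart_nonneg _) (negPart_nonneg _)
          (inf_eq_zero_of_le (posPart_nonneg _) (negPart_nonneg _) (hle i) (hle' n) (hd i n hi)),
        sub_zero]
  refine (hx ψ).of_nonneg_of_le (fun n => by positivity) fun n => ?_
  rw [key]
  refine Real.rpow_le_rpow (abs_nonneg _) ?_ hp
  have := abs_apply_le φ (x n)⁺
  rw [abs_of_nonneg (posPart_nonneg (x n))] at this
  exact this.trans (le_abs_self _)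

/-- Positive series with order bounded partial sums have weakly `p`-summable terms. -/
theorem weaklyPSummable_of_sum_le (hp : 1 ≤ p) {f : E} {g : ℕ → E}
    (hg : ∀ i, 0 ≤ g i) (hgf : ∀ N, ∑ i ∈ Finset.range N, g i ≤ f) : WeaklyPSummable p g :=
  fun φ => summable_rpow_of_summable_abs hp <| by
    refine summable_of_sum_range_le (c := |φ| f) (fun i => abs_nonneg _) fun N => ?_
    refine le_trans ?_ (map_mono (abs_nonneg φ) (hgf N))
    rw [map_sum]
    refine Finset.sum_le_sum fun i _ => ?_
    have := abs_apply_le φ (g i)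
    rwa [abs_of_nonneg (hg i)] at this

/-- The map `x ↦ (g k x)` is bounded into `ℓ¹`, and each choice of signs gives a bounded functional
on `E`, so the Schur property applies. -/
theorem tendsto_tsum_abs_apply {f : StrongDual ℝ E} {g : ℕ → StrongDual ℝ E}
    (hg : ∀ i, 0 ≤ g i) (hgf : ∀ N, ∑ i ∈ Finset.range N, g i ≤ f) {x : ℕ → E}
    (hx : WeaklyNull x) : Tendsto (fun n => ∑' k, |g k (x n)|) atTop (𝓝 0) := by
  refine tendsto_tsum_abs_of_signs (fun n => summable_abs_apply hg hgf (x n))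
    (fun k => hx (g k)) fun s => ?_
  obtain ⟨ψ, hψ⟩ := exists_weighted_sum hg hgf (fun k => if s k then 1 else -1) fun k => by
    cases s k <;> simp
  exact (hx ψ).congr fun n => hψ (x n)

theorem adjointOp_nonneg {F : Type*} [NormedAddCommGroup F] [NormedSpace ℝ F] [Lattice F]
    [IsOrderedAddMonoid F] [HasSolidNorm F] {T : E →L[ℝ] F} (hT : ∀ x, 0 ≤ x → 0 ≤ T x)
    {y : StrongDual ℝ F} (hy : 0 ≤ y) : 0 ≤ adjointOp T y :=
  fun x hx => apply_nonneg hy (hT x hx)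

variable [IsOrderedModule ℝ E] [CompleteSpace E]

/-- If the dual norm of `E` is order continuous, adjoints of positive almost weak `p`-convergent
operators are disjoint `p`-convergent. -/
theorem disjointPConvergent_adjointOp {F : Type*} [NormedAddCommGroup F] [NormedSpace ℝ F]
    [Lattice F] [IsOrderedAddMonoid F] [HasSolidNorm F] (hp : 0 < p)
    (hE : OrderContinuousNorm (StrongDual ℝ E)) {T : E →L[ℝ] F}
    (hT : ∀ x, 0 ≤ x → 0 ≤ T x) (hTp : AlmostWeakPConvergent p T) :
    DisjointPConvergent p (adjointOp T) := by
  have hpos : ∀ y : ℕ → StrongDual ℝ F, (∀ n, 0 ≤ y n) → DisjointSeq y → WeaklyPSummable p y →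
      Tendsto (fun n => ‖adjointOp T (y n)‖) atTop (𝓝 0) := by
    intro y hy hd hs
    by_contra hcon
    -- Pointwise convergence of `T* y n` at `x` is weak nullness of `y` tested on evaluation at `T
    -- x`.
    obtain ⟨δ, hδ, φ, hφ, u, hu, hu1, hud, hδu⟩ := exists_disjoint_of_not_tendsto
      (fun n => adjointOp_nonneg hT (hy n))
      (fun x => hs.weaklyNull hp (NormedSpace.inclusionInDoubleDual ℝ F (T x))) hcon
    have hlim := hTp u (y ∘ φ) (weaklyNull_of_disjoint hE hu hu1 hud)
      (fun m n hmn => hd _ _ (hφ.injective.ne hmn)) (hs.comp hφ)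
    exact absurd (ge_of_tendsto' hlim hδu) (not_le.2 hδ)
  intro y hd hs
  have h1 := hpos _ (fun n => posPart_nonneg (y n)) hd.posPart (hs.posPart hp.le hd)
  have h2 := hpos _ (fun n => posPart_nonneg (-y n)) hd.neg.posPart (hs.neg.posPart hp.le hd.neg)
  refine squeeze_zero (fun n => norm_nonneg _) (fun n => ?_) (by simpa using h1.add h2)
  have h3 : y n = (y n)⁺ - (-y n)⁺ := by
    rw [posPart_neg, posPart_sub_negPart]
  calc ‖adjointOp T (y n)‖ = ‖adjointOp T (y n)⁺ - adjointOp T (-y n)⁺‖ := by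
        rw [← map_sub, ← h3]
    _ ≤ _ := norm_sub_le _ _

/-- The operator `x ↦ ∑ k, g k x • u k`, which factors through `ℓ¹`. -/
theorem exists_tsum_smul {f : StrongDual ℝ E} {g : ℕ → StrongDual ℝ E} (hg : ∀ i, 0 ≤ g i)
    (hgf : ∀ N, ∑ i ∈ Finset.range N, g i ≤ f) {u : ℕ → E} (hu1 : ∀ k, ‖u k‖ ≤ 1) :
    ∃ T : E →L[ℝ] E, ∀ x, HasSum (fun k => g k x • u k) (T x) ∧ ‖T x‖ ≤ ∑' k, |g k x| := by
  have hle : ∀ x k, ‖g k x • u k‖ ≤ |g k x| := fun x k => by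
    rw [norm_smul, Real.norm_eq_abs]
    exact mul_le_of_le_one_right (abs_nonneg _) (hu1 k)
  have hsum : ∀ x, Summable fun k => g k x • u k := fun x =>
    Summable.of_norm_bounded (summable_abs_apply hg hgf x) (hle x)
  have hnorm : ∀ x, ‖∑' k, g k x • u k‖ ≤ ∑' k, |g k x| := fun x =>
    tsum_of_norm_bounded (summable_abs_apply hg hgf x).hasSum (hle x)
  have hbound : ∀ x, ‖∑' k, g k x • u k‖ ≤ ‖f‖ * ‖x‖ := fun x => by
    refine (hnorm x).trans ((summable_abs_apply hg hgf x).tsum_le_of_sum_range_le fun N => ?_)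
    have h1 := hgf N |x| (abs_nonneg x)
    rw [sum_apply] at h1
    have h2 := apply_le f (abs_nonneg x) le_rfl
    rw [norm_abs_eq_norm] at h2
    exact (Finset.sum_le_sum fun i _ => abs_map_le (hg i) x).trans (h1.trans h2)
  have hadd : ∀ x y, ∑' k, g k (x + y) • u k = ∑' k, g k x • u k + ∑' k, g k y • u k :=
    fun x y => by
      rw [← (hsum x).tsum_add (hsum y)]
      exact tsum_congr fun k => by rw [map_add, add_smul]
  have hsmul : ∀ (c : ℝ) x, ∑' k, g k (c • x) • u k = c • ∑' k, g k x • u k := fun c x => by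
    rw [← (hsum x).tsum_const_smul c]
    exact tsum_congr fun k => by rw [map_smul, smul_assoc]
  let L : E →ₗ[ℝ] E := IsLinearMap.mk' (fun x => ∑' k, g k x • u k) ⟨hadd, hsmul⟩
  exact ⟨L.mkContinuous ‖f‖ hbound, fun x => ⟨(hsum x).hasSum, hnorm x⟩⟩

/-- If the dual norm is not order continuous, some positive almost weak `p`-convergent operator
has an adjoint that is not disjoint `p`-convergent. -/
theorem exists_not_disjointPConvergent_adjointOp (hp : 1 ≤ p)
    (hE : ¬ OrderContinuousNorm (StrongDual ℝ E)) :
    ∃ T : E →L[ℝ] E, (∀ x, 0 ≤ x → 0 ≤ T x) ∧ AlmostWeakPConvergent p T ∧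
      ¬ DisjointPConvergent p (adjointOp T) := by
  obtain ⟨f, hf, δ, hδ, u, hu, hu1, hud, hδu⟩ := exists_disjoint_of_not_orderContinuousNorm hE
  choose g hg using fun k => exists_isComponent hf (hu k)
  have hg0 := fun i => (hg i).nonneg hf (hu i)
  have hgf := IsComponent.sum_le hg hf hu hud
  have hgd : DisjointSeq g := fun m n hmn => by
    rw [abs_of_nonneg (hg0 m), abs_of_nonneg (hg0 n)]
    exact (hg m).inf_eq_zero hf (hu m) (hg n) (hu n) (hud m n hmn)
  obtain ⟨T, hT⟩ := exists_tsum_smul hg0 hgf hu1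
  refine ⟨T, fun x hx => (hT x).1.nonneg fun k => smul_nonneg (apply_nonneg (hg0 k) hx) (hu k),
    fun x y hx _ hys => ?_, fun hcon => ?_⟩
  -- Since `T x n` is norm null, only boundedness of `y` is needed.
  · obtain ⟨C, hC⟩ := (hys.weaklyNull (one_pos.trans_le hp)).exists_norm_le
    have hlim := (tendsto_tsum_abs_apply hg0 hgf hx).const_mul C
    rw [mul_zero] at hlim
    refine squeeze_zero_norm (fun n => ((y n).le_opNorm _).trans ?_) hlim
    exact mul_le_mul (hC n) (hT (x n)).2 (norm_nonneg _) ((norm_nonneg _).trans (hC n))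
  · have hlim := hcon g hgd (weaklyPSummable_of_sum_le hp hg0 hgf)
    refine absurd (ge_of_tendsto' hlim fun n => ?_) (not_le.2 (mul_pos hδ hδ))
    have hgu : δ ≤ g n (u n) := by rw [(hg n).apply_self (hu n)]; exact hδu n
    -- All terms of the series for `T (u n)` are positive, so it dominates its `n`-th term; applying
    -- `g n` gives the lower bound `δ * δ`.
    have h1 : g n (u n) • u n ≤ T (u n) :=
      le_hasSum (hT (u n)).1 n fun k _ => smul_nonneg (apply_nonneg (hg0 k) (hu n)) (hu k)
    have h2 := map_mono (hg0 n) h1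
    rw [map_smul, smul_eq_mul] at h2
    have h3 : g n (T (u n)) ≤ ‖adjointOp T (g n)‖ :=
      (le_abs_self _).trans (((adjointOp T (g n)).le_opNorm (u n)).trans
        (mul_le_of_le_one_right (norm_nonneg _) (hu1 n)))
    exact (mul_le_mul hgu hgu hδ.le (hδ.le.trans hgu)).trans (h2.trans h3)

end BanachLattice

end BanachLatticeDual

theorem corollary3p14 {E : Type*} [NormedAddCommGroup E] [NormedSpace ℝ E] [CompleteSpace E]
    [Lattice E] [IsOrderedAddMonoid E] [IsOrderedModule ℝ E] [HasSolidNorm E]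
    (p : ℝ) (hp : 1 ≤ p) :
    BanachLatticeDual.OrderContinuousNorm (StrongDual ℝ E) ↔
      ∀ T : E →L[ℝ] E, (∀ x : E, 0 ≤ x → 0 ≤ T x) →
        BanachLatticeDual.AlmostWeakPConvergent p T →
          BanachLatticeDual.DisjointPConvergent p (BanachLatticeDual.adjointOp T) := by
  refine ⟨fun hE T hT hTp => BanachLatticeDual.disjointPConvergent_adjointOp
    (one_pos.trans_le hp) hE hT hTp, fun h => ?_⟩
  by_contra hE
  obtain ⟨T, hT, hTp, hTd⟩ :=
    BanachLatticeDual.exists_not_disjointPConvergent_adjointOp hp hE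
  exact hTd (h T hT hTp)
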